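/- Let $V$ and $H$ be real separable Hilbert spaces such that $V$ is compactly and densely embedded in $H$. Identify $H$ with its dual, so that $V \subseteq H \cong H^* \subseteq V^*$, where $\langle h, v\rangle_{V^*\times V} = (h,v)_H$ for $h\in H$, $v\in V$. Let $A : V \to V^*$ be a bounded linear operator that is strongly positive, i.e. there is $\mu_V>0$ with $\langle Au,u\rangle_{V^*\times V} \ge \mu_V\|u\|_V^2$ for all $u\in V$, and let $\mu_H \in \mathbb R$ be a constant such that $\langle Au,u\rangle_{V^*\times V} \ge \mu_H\|u\|_H^2$ for all $u\in V$. Let $A^* : V\to V^*$ denote the dual operator, $\langle A^*u,v\rangle_{V^*\times V}=\langle Av,u\rangle_{V^*\times V}$. For Hilbert spaces $X,Y$ let $HS(X,Y)$ be the space of Hilbert--Schmidt operators from $X$ to $Y$, i.e. of bounded linear operators $T$ with $\sum_i \|Te_i\|_Y^2<\infty$ for an (equivalently, every) orthonormal basis $(e_i)$ of $X$. Let $\mathcal V = HS(V^*,H)\cap HS(H,V)$, the intersection being taken in the space $L(V,V^*)$ of bounded linear operators. For $c\in\mathbb R$ let $$C_c = \{P\in HS(H,H) : P=P^*,\ (Pu,u)_H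 \ge c\,\|u\|_H^2 \text{ for all } u\in H\}.$$ Let $0\le\gamma<\mu_H$. Then for every $Q\in C_{-\gamma^2}$ there exists $P\in\mathcal V\cap C_{-\gamma}$ such that $$A^*P+PA+P^2=Q,$$ where the equation is understood in $\mathcal V^* = HS(V,H)+HS(H,V^*)\subseteq L(V,V^*)$. -/

import Mathlib

namespace RiccatiHS

section HilbertSchmidt

variable {X : Type*} [NormedAddCommGroup X] [InnerProductSpace ℝ X]
variable {Y : Type*} [NormedAddCommGroup Y] [InnerProductSpace ℝ Y]

/-- A bounded linear operator `T` between real Hilbert spaces is a Hilbert--Schmidt operator if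
`∑ ‖T eᵢ‖² < ∞` for an orthonormal basis `(eᵢ)` of the domain. The choice of the basis is
irrelevant, see `isHilbertSchmidt_iff`. -/
def IsHilbertSchmidt (T : X →L[ℝ] Y) : Prop :=
  ∃ (w : Set X) (e : HilbertBasis w ℝ X), Summable fun i => ‖T (e i)‖ ^ 2

/-- Parseval's identity, with values in `[0, ∞]`. -/
theorem tsum_enorm_inner_sq {κ : Type*} (c : HilbertBasis κ ℝ Y) (y : Y) :
    ∑' k, ENNReal.ofReal (inner ℝ y (c k) ^ 2) = ENNReal.ofReal (‖y‖ ^ 2) := by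
  have h := c.hasSum_inner_mul_inner y y
  have h2 : HasSum (fun k => inner ℝ y (c k) ^ 2) (‖y‖ ^ 2) := by
    rw [← real_inner_self_eq_norm_sq]
    refine h.congr_fun fun k => ?_
    rw [real_inner_comm y (c k), sq]
  rw [← ENNReal.ofReal_tsum_of_nonneg (fun _ => sq_nonneg _) h2.summable, h2.tsum_eq]

theorem summable_iff_tsum_ofReal {ι : Type*} {f : ι → ℝ} (hf : ∀ i, 0 ≤ f i) :
    Summable f ↔ ∑' i, ENNReal.ofReal (f i) ≠ ⊤ := by
  constructor
  · intro h
    rw [← ENNReal.ofReal_tsum_of_nonneg hf h]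
    exact ENNReal.ofReal_ne_top
  · intro h
    have h1 := ENNReal.summable_toReal h
    refine h1.congr ?_
    intro i
    exact ENNReal.toReal_ofReal (hf i)

variable [CompleteSpace X] [CompleteSpace Y]

theorem tsum_adjoint {ι κ : Type*} (e : HilbertBasis ι ℝ X) (c : HilbertBasis κ ℝ Y)
    (T : X →L[ℝ] Y) :
    ∑' i, ENNReal.ofReal (‖T (e i)‖ ^ 2) =
      ∑' k, ENNReal.ofReal (‖ContinuousLinearMap.adjoint T (c k)‖ ^ 2) := by
  simp_rw [← tsum_enorm_inner_sq c, ← tsum_enorm_inner_sq e]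
  rw [ENNReal.tsum_comm]
  refine tsum_congr fun k => tsum_congr fun i => ?_
  rw [ContinuousLinearMap.adjoint_inner_left, real_inner_comm]

/-- The Hilbert--Schmidt property may be tested on an arbitrary orthonormal basis. -/
theorem isHilbertSchmidt_iff {ι : Type*} (e : HilbertBasis ι ℝ X) (T : X →L[ℝ] Y) :
    IsHilbertSchmidt T ↔ Summable fun i => ‖T (e i)‖ ^ 2 := by
  obtain ⟨v, c, -⟩ := exists_hilbertBasis ℝ Y
  obtain ⟨u, d, -⟩ := exists_hilbertBasis ℝ X
  constructor
  · rintro ⟨w, b, hb⟩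
    rw [summable_iff_tsum_ofReal fun _ => sq_nonneg _] at hb ⊢
    rwa [tsum_adjoint e c, ← tsum_adjoint b c]
  · intro he
    refine ⟨u, d, ?_⟩
    rw [summable_iff_tsum_ofReal fun _ => sq_nonneg _] at he ⊢
    rwa [tsum_adjoint d c, ← tsum_adjoint e c]

end HilbertSchmidt

section Dual

variable {V : Type*} [NormedAddCommGroup V] [InnerProductSpace ℝ V] [CompleteSpace V]

/-- The dual `V*` of a real Hilbert space, with its usual dual norm, is a Hilbert space: the inner
product inducing the dual norm is transported along the Riesz isomorphism. -/
noncomputable instance instInnerProductSpaceDual : InnerProductSpace ℝ (StrongDual ℝ V) where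
  inner f g := inner ℝ ((InnerProductSpace.toDual ℝ V).symm f)
    ((InnerProductSpace.toDual ℝ V).symm g)
  norm_sq_eq_re_inner f := by
    simp
  conj_inner_symm _ _ := real_inner_comm _ _
  add_left f g h := by
    simp [inner_add_left]
  smul_left f g r := by
    simp [inner_smul_left]

end Dual

section GelfandTriple

variable {V : Type*} [NormedAddCommGroup V] [InnerProductSpace ℝ V]
variable {H : Type*} [NormedAddCommGroup H] [InnerProductSpace ℝ H]

/-- The embedding `H ≅ H* → V*` of the Gelfand triple given by `j : V → H`, that is,
`⟨h, v⟩_{V* × V} = (h, j v)_H`. -/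
noncomputable def pivot (j : V →L[ℝ] H) : H →L[ℝ] StrongDual ℝ V :=
  (innerSL ℝ).bilinearComp (ContinuousLinearMap.id ℝ H) j

@[simp]
theorem pivot_apply (j : V →L[ℝ] H) (h : H) (v : V) : pivot j h v = inner ℝ h (j v) := rfl

/-- An element of `𝒱 = HS(V*, H) ∩ HS(H, V)`: a Hilbert--Schmidt operator `ofDual : V* → H` and a
Hilbert--Schmidt operator `intoV : H → V` that are the same operator, i.e. the restriction of
`ofDual` to `H ⊆ V*` is `intoV`, regarded as an operator with values in `H ⊇ V`. For a dense
embedding this is the same as equality in `L(V, V*)`, see `compat_iff`. -/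
structure OperatorV [CompleteSpace V] (j : V →L[ℝ] H) where
  ofDual : StrongDual ℝ V →L[ℝ] H
  intoV : H →L[ℝ] V
  isHilbertSchmidt_ofDual : IsHilbertSchmidt ofDual
  isHilbertSchmidt_intoV : IsHilbertSchmidt intoV
  compat : ofDual ∘L pivot j = j ∘L intoV

theorem compat_iff (j : V →L[ℝ] H) (hj : DenseRange j)
    (S : StrongDual ℝ V →L[ℝ] H) (T : H →L[ℝ] V) :
    S ∘L pivot j = j ∘L T ↔
      pivot j ∘L S ∘L pivot j ∘L j = pivot j ∘L j ∘L T ∘L j := by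
  constructor
  · intro h
    ext u v
    have h1 : S (pivot j (j u)) = j (T (j u)) := congrArg (fun L : H →L[ℝ] H => L (j u)) h
    simp [h1]
  · intro h
    have h1 : ∀ u, (S ∘L pivot j) (j u) = (j ∘L T) (j u) := by
      intro u
      refine hj.eq_of_inner_left (𝕜 := ℝ) ?_
      intro v
      exact congrArg (fun L : V →L[ℝ] StrongDual ℝ V => L u v) h
    ext x
    exact congrFun (hj.equalizer (S ∘L pivot j).continuous (j ∘L T).continuous (funext h1)) x

variable [CompleteSpace V]

/-- The element `P ∈ 𝒱` as an operator on `H`. -/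
def OperatorV.toH {j : V →L[ℝ] H} (P : OperatorV j) : H →L[ℝ] H := j ∘L P.intoV

/-- The dual operator `A* : V → V*` of `A : V → V*`, i.e. `⟨A* u, v⟩ = ⟨A v, u⟩`. -/
noncomputable def dualOperator (A : V →L[ℝ] StrongDual ℝ V) : V →L[ℝ] StrongDual ℝ V := A.flip

/-- The operator `A* P : H → V*`. -/
noncomputable def OperatorV.dualMul {j : V →L[ℝ] H} (A : V →L[ℝ] StrongDual ℝ V)
    (P : OperatorV j) : H →L[ℝ] StrongDual ℝ V := dualOperator A ∘L P.intoV

/-- The operator `P A : V → H`. -/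
noncomputable def OperatorV.mulOp {j : V →L[ℝ] H} (P : OperatorV j)
    (A : V →L[ℝ] StrongDual ℝ V) : V →L[ℝ] H := P.ofDual ∘L A

/-- `A* P + P A`, as an element of `HS(H, V*) + HS(V, H) ⊆ L(V, V*)`. -/
noncomputable def lyapunov {j : V →L[ℝ] H} (A : V →L[ℝ] StrongDual ℝ V) (P : OperatorV j) :
    V →L[ℝ] StrongDual ℝ V :=
  P.dualMul A ∘L j + pivot j ∘L P.mulOp A

/-- An operator on `H` as an element of `L(V, V*)`, through `V ⊆ H ⊆ V*`. -/
noncomputable def toVDual (j : V →L[ℝ] H) (R : H →L[ℝ] H) : V →L[ℝ] StrongDual ℝ V :=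
  pivot j ∘L R ∘L j

/-- The algebraic Riccati equation `A* P + P A + P² = Q` for `P ∈ 𝒱`, as an equation in
`𝒱* = HS(V, H) + HS(H, V*) ⊆ L(V, V*)`. -/
def IsRiccatiSolution (j : V →L[ℝ] H) (A : V →L[ℝ] StrongDual ℝ V) (Q : H →L[ℝ] H)
    (P : OperatorV j) : Prop :=
  lyapunov A P + toVDual j (P.toH ∘L P.toH) = toVDual j Q

end GelfandTriple

section LowerBound

/-- The set `C_c` of self-adjoint Hilbert--Schmidt operators `P` on `H` with `P ≥ c`, i.e.
`((P - c I) u, u)_H ≥ 0` for all `u ∈ H`. -/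
def lowerBoundedHS (H : Type*) [NormedAddCommGroup H] [InnerProductSpace ℝ H] [CompleteSpace H]
    (c : ℝ) : Set (H →L[ℝ] H) :=
  {P | IsHilbertSchmidt P ∧ IsSelfAdjoint P ∧
    ∀ u : H, 0 ≤ inner ℝ ((P - c • ContinuousLinearMap.id ℝ H) u) u}

end LowerBound

end RiccatiHS

open scoped RealInnerProductSpace InnerProductSpace

/-! The solution is a fixed point of the map sending `P` to the solution `R` of `(A + M)* R + R (A +
M) = Q + 2 M P - P²`, where the shift `M > 0` is large. The right-hand side is `Q + M² - (M - P)²`,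
and everything rests on `0 ≤ M - P ≤ M + γ` for `-γ ≤ P ≤ M`.

Lax–Milgram on symmetric Hilbert–Schmidt operators `H → V` solves the linear equation
(`exists_lyapunov_weak`, `lyapunov_of_weak`). Its solutions are compact on `H`, so testing on
eigenvectors passes bounds from the right-hand side to `R` (`neg_mul_norm_sq_le_of_lyapunov`); hence
`-γ ≤ R ≤ M` is preserved.

For the contraction, differences of right-hand sides factor as `(M - P) D + D (M - P')` with `D = P
- P'`, of Hilbert–Schmidt norm at most `2 (M + γ) ‖D‖` (`norm_shiftedRhs_sub_le`). The Lyapunov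
solve gains `1 / (2 (μH + M))`, so the ratio is `(M + γ) / (μH + M) < 1`. -/

namespace RiccatiHS

/-! ### Hilbert–Schmidt operators as square summable families -/

section Sequences

variable {ι : Type*}
variable {Y : Type*} [NormedAddCommGroup Y] [InnerProductSpace ℝ Y]
variable {Z : Type*} [NormedAddCommGroup Z] [InnerProductSpace ℝ Z]
variable {H : Type*} [NormedAddCommGroup H] [InnerProductSpace ℝ H]

/-- Square summable families of vectors of `Y`. For an index set of a Hilbert basis of `H`, they
are the Hilbert--Schmidt operators from `H` to `Y`, see `opOfSeq`. -/
abbrev SqSum (ι Y : Type*) [NormedAddCommGroup Y] := lp (fun _ : ι => Y) 2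

/-- A bounded linear operator, applied to each member of a square summable family. -/
noncomputable def lpMap (F : Y →L[ℝ] Z) : SqSum ι Y →L[ℝ] SqSum ι Z :=
  lp.mapCLM 2 (fun _ => F) (norm_nonneg F) (fun _ => le_rfl)

@[simp]
theorem lpMap_apply (F : Y →L[ℝ] Z) (x : SqSum ι Y) (i : ι) : lpMap F x i = F (x i) := rfl

theorem norm_lpMap_apply_le (F : Y →L[ℝ] Z) (x : SqSum ι Y) : ‖lpMap F x‖ ≤ ‖F‖ * ‖x‖ :=
  (lpMap F).le_of_opNorm_le (lp.norm_mapCLM_le 2 (fun _ => F) (norm_nonneg F) fun _ => le_rfl) x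

theorem mul_norm_lpMap_sq_le {c : ℝ} {F : Y →L[ℝ] Z} {G : Y →L[ℝ] Y}
    (h : ∀ v, c * ‖F v‖ ^ 2 ≤ ⟪G v, v⟫) (x : SqSum ι Y) :
    c * ‖lpMap F x‖ ^ 2 ≤ ⟪lpMap G x, x⟫ := by
  rw [← real_inner_self_eq_norm_sq]
  refine hasSum_le (fun i => ?_) ((lp.hasSum_inner (𝕜 := ℝ) (lpMap F x) (lpMap F x)).mul_left c)
    (lp.hasSum_inner (lpMap G x) x)
  simpa using h (x i)

theorem hasSum_norm_sq (x : SqSum ι Y) : HasSum (fun i => ‖x i‖ ^ 2) (‖x‖ ^ 2) := by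
  simpa using lp.hasSum_inner (𝕜 := ℝ) x x

theorem memℓp_two_iff {E : Type*} [NormedAddCommGroup E] {f : ι → E} :
    Memℓp f 2 ↔ Summable fun i => ‖f i‖ ^ 2 := by
  rw [memℓp_gen_iff (by simp)]
  simp

theorem ext_of_basis (e : HilbertBasis ι ℝ H) {S T : H →L[ℝ] Y} (h : ∀ i, S (e i) = T (e i)) :
    S = T := by
  ext u
  have hS := (e.hasSum_repr u).mapL S
  have hT := (e.hasSum_repr u).mapL T
  simp only [map_smul, h] at hS hT
  exact hS.unique hT

variable [CompleteSpace Y] [CompleteSpace Z]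

/-- The operator that maps the members of a Hilbert basis to a square summable family. -/
noncomputable def opOfSeq (e : HilbertBasis ι ℝ H) : SqSum ι Y →L[ℝ] H →L[ℝ] Y :=
  (lp.dualPairing 2 2 (fun _ => ContinuousLinearMap.lsmul ℝ ℝ)
    (K := ‖ContinuousLinearMap.lsmul ℝ ℝ (E := Y)‖₊) (fun _ => le_rfl) ∘L
    (e.repr : H →L[ℝ] SqSum ι ℝ)).flip

theorem opOfSeq_basis (e : HilbertBasis ι ℝ H) (x : SqSum ι Y) (i : ι) :
    opOfSeq e x (e i) = x i := by
  classical
  have h : opOfSeq e x (e i) = ∑' k, e.repr (e i) k • x k := rfl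
  rw [h, tsum_eq_single i fun k hk => ?_]
  · simp [e.repr_self]
  · rw [e.repr_self, lp.single_apply_ne _ _ _ hk, zero_smul]

theorem hasSum_opOfSeq (e : HilbertBasis ι ℝ H) (x : SqSum ι Y) (h : H) :
    HasSum (fun i => ⟪e i, h⟫ • x i) (opOfSeq e x h) := by
  simpa [e.repr_apply_apply, opOfSeq_basis] using (e.hasSum_repr h).mapL (opOfSeq e x)

theorem opOfSeq_lpMap (e : HilbertBasis ι ℝ H) (F : Y →L[ℝ] Z) (x : SqSum ι Y) :
    opOfSeq e (lpMap F x) = F ∘L opOfSeq e x :=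
  ext_of_basis e fun i => by simp [opOfSeq_basis]

theorem isHilbertSchmidt_opOfSeq [CompleteSpace H] (e : HilbertBasis ι ℝ H) (x : SqSum ι Y) :
    IsHilbertSchmidt (opOfSeq e x) := by
  rw [isHilbertSchmidt_iff e]
  simpa [opOfSeq_basis] using (hasSum_norm_sq x).summable

theorem IsHilbertSchmidt.exists_opOfSeq_eq [CompleteSpace H] {T : H →L[ℝ] Y}
    (hT : IsHilbertSchmidt T) (e : HilbertBasis ι ℝ H) : ∃ x : SqSum ι Y, opOfSeq e x = T :=
  ⟨⟨fun i => T (e i), memℓp_two_iff.2 ((isHilbertSchmidt_iff e T).1 hT)⟩,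
    ext_of_basis e fun i => opOfSeq_basis e _ i⟩

/-- The Hilbert--Schmidt norm is invariant under passing to the adjoint. -/
theorem norm_eq_of_opOfSeq_eq_adjoint [CompleteSpace H] {e : HilbertBasis ι ℝ H}
    {x y : SqSum ι H} (h : opOfSeq e x = ContinuousLinearMap.adjoint (opOfSeq e y)) :
    ‖x‖ = ‖y‖ := by
  have key := tsum_adjoint e e (opOfSeq e y)
  simp only [← h, opOfSeq_basis] at key
  rw [← ENNReal.ofReal_tsum_of_nonneg (fun _ => sq_nonneg _) (hasSum_norm_sq x).summable,
    ← ENNReal.ofReal_tsum_of_nonneg (fun _ => sq_nonneg _) (hasSum_norm_sq y).summable,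
    (hasSum_norm_sq x).tsum_eq, (hasSum_norm_sq y).tsum_eq,
    ENNReal.ofReal_eq_ofReal_iff (sq_nonneg _) (sq_nonneg _)] at key
  exact ((sq_eq_sq₀ (norm_nonneg _) (norm_nonneg _)).1 key).symm

/-- The rank one operator `h ↦ (u, h) v`. -/
noncomputable def rankOneSeq (e : HilbertBasis ι ℝ H) (u : H) (v : Y) : SqSum ι Y :=
  lpMap (ContinuousLinearMap.toSpanSingleton ℝ v) (e.repr u)

theorem opOfSeq_rankOneSeq (e : HilbertBasis ι ℝ H) (u : H) (v : Y) (h : H) :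
    opOfSeq e (rankOneSeq e u v) h = ⟪u, h⟫ • v := by
  have h1 : opOfSeq e (rankOneSeq e u v) = (innerSL ℝ u).smulRight v :=
    ext_of_basis e fun i => by
      simp [opOfSeq_basis, rankOneSeq, e.repr_apply_apply, real_inner_comm]
  simp [h1]

/-- Pairing with rank one operators recovers matrix entries; this turns weak equations into
pointwise ones. -/
theorem inner_rankOneSeq (e : HilbertBasis ι ℝ H) (x : SqSum ι Y) (u : H) (v : Y) :
    ⟪x, rankOneSeq e u v⟫ = ⟪opOfSeq e x u, v⟫ := by
  refine (lp.hasSum_inner (𝕜 := ℝ) x _).unique ?_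
  simpa [rankOneSeq, e.repr_apply_apply, inner_smul_left, inner_smul_right, real_inner_comm]
    using (hasSum_opOfSeq e x u).mapL (innerSL ℝ v)

end Sequences

/-! ### The Lyapunov equation: existence and energy estimate -/

section Lyapunov

variable {ι : Type*}
variable {V : Type*} [NormedAddCommGroup V] [InnerProductSpace ℝ V] [CompleteSpace V]
variable {H : Type*} [NormedAddCommGroup H] [InnerProductSpace ℝ H]

/-- The Hilbert--Schmidt operators from `H` to `V` that are symmetric as operators on `H`. -/
noncomputable def symmSeq (e : HilbertBasis ι ℝ H) (j : V →L[ℝ] H) : Submodule ℝ (SqSum ι V) where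
  carrier := {x | ∀ h k, ⟪j (opOfSeq e x h), k⟫ = ⟪h, j (opOfSeq e x k)⟫}
  add_mem' hx hy h k := by
    simp only [map_add, add_apply, inner_add_left, inner_add_right, hx h k, hy h k]
  zero_mem' h k := by simp
  smul_mem' c x hx h k := by
    simp only [map_smul, smul_apply, inner_smul_left, inner_smul_right, hx h k]
    rfl

theorem isClosed_symmSeq (e : HilbertBasis ι ℝ H) (j : V →L[ℝ] H) :
    IsClosed (symmSeq e j : Set (SqSum ι V)) := by
  have : (symmSeq e j : Set (SqSum ι V)) =
      ⋂ h : H, ⋂ k : H, {x | ⟪j (opOfSeq e x h), k⟫ = ⟪h, j (opOfSeq e x k)⟫} := by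
    ext x
    simp [symmSeq]
  rw [this]
  exact isClosed_iInter fun h => isClosed_iInter fun k =>
    isClosed_eq (by fun_prop) (by fun_prop)

/-- The Lyapunov equation in weak form. -/
theorem exists_lyapunov_weak (e : HilbertBasis ι ℝ H) (j : V →L[ℝ] H) (B : V →L[ℝ] V)
    {μ : ℝ} (hμ : 0 < μ) (hB : ∀ v, μ * ‖v‖ ^ 2 ≤ ⟪B v, v⟫) (r : SqSum ι H) :
    ∃ x ∈ symmSeq e j, ∀ y ∈ symmSeq e j, 2 * ⟪lpMap B x, y⟫ = ⟪r, lpMap j y⟫ := by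
  have : CompleteSpace (symmSeq e j) := (isClosed_symmSeq e j).completeSpace_coe
  -- Against a symmetric test operator both terms of the Lyapunov operator contribute equally, hence
  -- one term with factor `2`.
  let a : symmSeq e j →L[ℝ] symmSeq e j →L[ℝ] ℝ :=
    (innerSL ℝ).bilinearComp ((2 : ℝ) • lpMap B ∘L (symmSeq e j).subtypeL) (symmSeq e j).subtypeL
  have ha : ∀ x y, a x y = 2 * ⟪lpMap B (x : SqSum ι V), (y : SqSum ι V)⟫ := fun x y => by
    simp [a]
  have hco : IsCoercive a := by
    refine ⟨2 * μ, by positivity, fun x => ?_⟩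
    have h := mul_norm_lpMap_sq_le (F := ContinuousLinearMap.id ℝ V) hB (x : SqSum ι V)
    have h1 : lpMap (ContinuousLinearMap.id ℝ V) (x : SqSum ι V) = x := rfl
    rw [h1] at h
    rw [ha, Submodule.coe_norm]
    linarith
  let f : StrongDual ℝ (symmSeq e j) := innerSL ℝ r ∘L lpMap j ∘L (symmSeq e j).subtypeL
  obtain ⟨x, hx⟩ := hco.continuousLinearEquivOfBilin.surjective
    ((InnerProductSpace.toDual ℝ (symmSeq e j)).symm f)
  refine ⟨x, x.2, fun y hy => ?_⟩
  have h := hco.continuousLinearEquivOfBilin_apply x ⟨y, hy⟩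
  rw [hx, InnerProductSpace.toDual_symm_apply, ha] at h
  exact h.symm

/-- Only symmetric tests are available, so the equation is tested with the symmetrised rank one
operator built from `u` and `v`; symmetry of `r` merges the two resulting right-hand terms. -/
theorem lyapunov_of_weak [CompleteSpace H] {e : HilbertBasis ι ℝ H} {j : V →L[ℝ] H} {B : V →L[ℝ] V}
    {r : SqSum ι H} (hr : ∀ h k, ⟪opOfSeq e r h, k⟫ = ⟪h, opOfSeq e r k⟫) {x : SqSum ι V}
    (hx : ∀ y ∈ symmSeq e j, 2 * ⟪lpMap B x, y⟫ = ⟪r, lpMap j y⟫) (u v : V) :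
    ⟪B (opOfSeq e x (j u)), v⟫ + ⟪B (opOfSeq e x (j v)), u⟫ = ⟪opOfSeq e r (j u), j v⟫ := by
  have hy : rankOneSeq e (j u) v + rankOneSeq e (j v) u ∈ symmSeq e j := by
    intro h k
    simp only [map_add, add_apply, opOfSeq_rankOneSeq, map_smul, inner_add_left, inner_add_right,
      real_inner_smul_left, real_inner_smul_right, real_inner_comm h]
    ring
  have h := hx _ hy
  have hj : ∀ (u : H) (v : V), lpMap j (rankOneSeq e u v) = rankOneSeq e u (j v) := fun u v => by
    ext i
    simp [rankOneSeq]
  simp only [map_add, inner_add_right, hj, inner_rankOneSeq, opOfSeq_lpMap,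
    ContinuousLinearMap.comp_apply] at h
  rw [hr (j v) (j u), real_inner_comm _ (j v)] at h
  linarith

/-- The energy estimate for the Lyapunov equation. -/
theorem mul_norm_sub_le_of_lyapunov {j : V →L[ℝ] H} {B : V →L[ℝ] V} {b : ℝ}
    (hB : ∀ v, b * ‖j v‖ ^ 2 ≤ ⟪B v, v⟫) {r r' : SqSum ι H} {x x' : SqSum ι V}
    (hxs : x ∈ symmSeq e j) (hx's : x' ∈ symmSeq e j)
    (hx : ∀ y ∈ symmSeq e j, 2 * ⟪lpMap B x, y⟫ = ⟪r, lpMap j y⟫)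
    (hx' : ∀ y ∈ symmSeq e j, 2 * ⟪lpMap B x', y⟫ = ⟪r', lpMap j y⟫) :
    2 * b * ‖lpMap j x - lpMap j x'‖ ≤ ‖r - r'‖ := by
  rw [← map_sub]
  have hmem := Submodule.sub_mem _ hxs hx's
  -- The difference of the two equations is tested with the difference of the solutions.
  have h1 : 2 * ⟪lpMap B (x - x'), x - x'⟫ = ⟪r - r', lpMap j (x - x')⟫ := by
    rw [map_sub (lpMap B), inner_sub_left, inner_sub_left, mul_sub, hx _ hmem, hx' _ hmem]
  have h2 := mul_norm_lpMap_sq_le hB (x - x')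
  have h3 := real_inner_le_norm (r - r') (lpMap j (x - x'))
  rcases (norm_nonneg (lpMap j (x - x'))).eq_or_lt with h0 | h0
  · rw [← h0, mul_zero]
    exact norm_nonneg _
  · refine le_of_mul_le_mul_right ?_ h0
    linarith

end Lyapunov

/-! ### Quadratic form bounds for symmetric operators -/

section Operators

variable {H : Type*} [NormedAddCommGroup H] [InnerProductSpace ℝ H]

open Module Module.End in
/-- A compact symmetric operator is bounded from below by any lower bound of its eigenvalues. -/
theorem mul_norm_sq_le_inner_of_eigenvalues [CompleteSpace H] {P : H →L[ℝ] H}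
    (hP : IsCompactOperator P)
    (hs : ∀ u v, ⟪P u, v⟫ = ⟪u, P v⟫) {c : ℝ}
    (hc : ∀ (lam : ℝ) (v : H), v ≠ 0 → P v = lam • v → c ≤ lam) (u : H) :
    c * ‖u‖ ^ 2 ≤ ⟪P u, u⟫ := by
  have hs' : (P : H →ₗ[ℝ] H).IsSymmetric := hs
  -- By the spectral theorem finite sums of eigenvectors are dense; on these the form is diagonal.
  have hd : Dense ((⨆ μ, eigenspace (P : End ℝ H) μ : Submodule ℝ H) : Set H) := by
    rw [Submodule.dense_iff_topologicalClosure_eq_top, Submodule.topologicalClosure_eq_top_iff]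
    exact ContinuousLinearMap.orthogonalComplement_iSup_eigenspaces_eq_bot hP hs'
  have hcl : IsClosed {u : H | c * ‖u‖ ^ 2 ≤ ⟪P u, u⟫} :=
    isClosed_le (by fun_prop) (by fun_prop)
  refine hcl.closure_subset_iff.2 (fun w hw => ?_) (hd u)
  obtain ⟨f, hf, rfl⟩ := (Submodule.mem_iSup_iff_exists_finsupp _ _).1 hw
  have hPf : ∀ μ, P (f μ) = μ • f μ := fun μ => mem_eigenspace_iff.1 (hf μ)
  have horth : ∀ μ ν, μ ≠ ν → ⟪f μ, f ν⟫ = 0 := fun μ ν hne =>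
    hs'.orthogonalFamily_eigenspaces hne ⟨f μ, hf μ⟩ ⟨f ν, hf ν⟩
  have hsum : ∀ g : ℝ → ℝ, ⟪∑ μ ∈ f.support, g μ • f μ, ∑ μ ∈ f.support, f μ⟫ =
      ∑ μ ∈ f.support, g μ * ‖f μ‖ ^ 2 := fun g => by
    rw [sum_inner]
    refine Finset.sum_congr rfl fun μ hμ => ?_
    rw [inner_sum, Finset.sum_eq_single_of_mem μ hμ, real_inner_smul_left,
      real_inner_self_eq_norm_sq]
    intro ν _ hne
    rw [real_inner_smul_left, horth μ ν hne.symm, mul_zero]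
  have h1 := hsum fun _ => c
  have h2 := hsum fun μ => μ
  simp only [← Finset.smul_sum, real_inner_smul_left, real_inner_self_eq_norm_sq] at h1
  simp only [Set.mem_ofPred_eq, Finsupp.sum, map_sum, hPf]
  rw [h1, h2]
  refine Finset.sum_le_sum fun μ hμ => ?_
  gcongr
  exact hc μ (f μ) (Finsupp.mem_support_iff.1 hμ) (hPf μ)

/-- Positivity at `c u - X u`, with the upper bound at `X u`, gives `‖X u‖² ≤ c (X u, u)`. -/
theorem norm_le_of_symmetric_of_le {X : H →L[ℝ] H} (hs : ∀ u v, ⟪X u, v⟫ = ⟪u, X v⟫)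
    (h0 : ∀ u, 0 ≤ ⟪X u, u⟫) {c : ℝ} (hc : 0 < c) (h1 : ∀ u, ⟪X u, u⟫ ≤ c * ‖u‖ ^ 2) :
    ‖X‖ ≤ c := by
  refine X.opNorm_le_bound hc.le fun u => ?_
  have hw := h0 (c • u - X u)
  have hX := h1 (X u)
  have e1 : ⟪X (X u), u⟫ = ‖X u‖ ^ 2 := by rw [hs, real_inner_self_eq_norm_sq]
  simp only [map_sub, map_smul, inner_sub_left, inner_sub_right, real_inner_smul_left,
    real_inner_smul_right, real_inner_self_eq_norm_sq, e1] at hw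
  have h2 : c * ‖X u‖ ^ 2 ≤ c * (c * ⟪X u, u⟫) := by nlinarith
  have h3 : ‖X u‖ ^ 2 ≤ (c * ‖u‖) ^ 2 := by
    nlinarith [le_of_mul_le_mul_left h2 hc, mul_le_mul_of_nonneg_left (h1 u) hc.le]
  exact (sq_le_sq₀ (norm_nonneg _) (by positivity)).1 h3

end Operators

/-! ### Order bounds for Lyapunov solutions -/

section LowerBound

variable {V : Type*} [NormedAddCommGroup V] [InnerProductSpace ℝ V]
variable {H : Type*} [NormedAddCommGroup H] [InnerProductSpace ℝ H] [CompleteSpace H]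

/-- A solution of a Lyapunov equation inherits a lower bound from the right-hand side. -/
theorem neg_mul_norm_sq_le_of_lyapunov {j : V →L[ℝ] H} (hj : IsCompactOperator j)
    {B : V →L[ℝ] V} {b : ℝ} (hB : ∀ v, b * ‖j v‖ ^ 2 ≤ ⟪B v, v⟫) (hb : 0 < b) {T : H →L[ℝ] V}
    (hs : ∀ h k, ⟪j (T h), k⟫ = ⟪h, j (T k)⟫) {R : H →L[ℝ] H}
    (hR : ∀ u v, ⟪B (T (j u)), v⟫ + ⟪B (T (j v)), u⟫ = ⟪R (j u), j v⟫) {c : ℝ} (hc : 0 ≤ c)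
    (hRc : ∀ u, -(2 * b * c) * ‖u‖ ^ 2 ≤ ⟪R u, u⟫) (u : H) :
    -c * ‖u‖ ^ 2 ≤ ⟪j (T u), u⟫ := by
  refine mul_norm_sq_le_inner_of_eigenvalues (P := j ∘L T) (hj.comp_clm T) hs
    (fun lam v hv hlam => ?_) u
  by_contra! hlt
  have hne : lam ≠ 0 := by linarith
  -- An eigenvector `v` with `lam < -c ≤ 0` lies in the range of `j`, so the equation may be tested
  -- at its preimage `w`: `2 lam (B w, w) = (R v, v)`. The left side is at most `2 lam b ‖v‖²`,
  -- which is below `-2 b c ‖v‖²`.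
  have hjw : j (lam⁻¹ • T v) = v := by
    rw [map_smul, show j (T v) = lam • v from hlam, inv_smul_smul₀ hne]
  have hTv : T v = lam • lam⁻¹ • T v := (smul_inv_smul₀ hne _).symm
  have h1 := hR (lam⁻¹ • T v) (lam⁻¹ • T v)
  have h2 := hB (lam⁻¹ • T v)
  rw [hjw] at h1 h2
  generalize lam⁻¹ • T v = w at *
  rw [hTv, map_smul, real_inner_smul_left] at h1
  have hv2 : 0 < ‖v‖ ^ 2 := by positivity
  have h3 := hRc v
  have h4 : 0 < b * ‖v‖ ^ 2 * (-c - lam) := mul_pos (mul_pos hb hv2) (by linarith)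
  nlinarith [mul_le_mul_of_nonneg_left h2 (by linarith : 0 ≤ -lam)]

theorem le_mul_norm_sq_of_lyapunov {j : V →L[ℝ] H} (hj : IsCompactOperator j)
    {B : V →L[ℝ] V} {b : ℝ} (hB : ∀ v, b * ‖j v‖ ^ 2 ≤ ⟪B v, v⟫) (hb : 0 < b) {T : H →L[ℝ] V}
    (hs : ∀ h k, ⟪j (T h), k⟫ = ⟪h, j (T k)⟫) {R : H →L[ℝ] H}
    (hR : ∀ u v, ⟪B (T (j u)), v⟫ + ⟪B (T (j v)), u⟫ = ⟪R (j u), j v⟫) {c : ℝ} (hc : 0 ≤ c)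
    (hRc : ∀ u, ⟪R u, u⟫ ≤ 2 * b * c * ‖u‖ ^ 2) (u : H) :
    ⟪j (T u), u⟫ ≤ c * ‖u‖ ^ 2 := by
  have h := neg_mul_norm_sq_le_of_lyapunov hj hB hb (T := -T) (R := -R) (by simpa using hs)
    (fun u v => by
      have := hR u v
      simp only [neg_apply, map_neg, inner_neg_left]
      linarith) hc
    (fun u => by
      have := hRc u
      simp only [neg_apply, inner_neg_left]
      linarith) u
  simp only [neg_apply, map_neg, inner_neg_left] at h
  linarith

end LowerBound

/-! ### Adjoints of Hilbert–Schmidt operators -/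

section Adjoint

variable {X : Type*} [NormedAddCommGroup X] [InnerProductSpace ℝ X] [CompleteSpace X]
variable {Y : Type*} [NormedAddCommGroup Y] [InnerProductSpace ℝ Y] [CompleteSpace Y]

theorem IsHilbertSchmidt.adjoint {T : X →L[ℝ] Y} (hT : IsHilbertSchmidt T) :
    IsHilbertSchmidt (ContinuousLinearMap.adjoint T) := by
  obtain ⟨w, e, he⟩ := hT
  obtain ⟨u, d, -⟩ := exists_hilbertBasis ℝ Y
  refine ⟨u, d, ?_⟩
  rw [summable_iff_tsum_ofReal fun _ => sq_nonneg _] at he ⊢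
  rwa [← tsum_adjoint e d]

end Adjoint

/-! ### From symmetric operators `H → V` to elements of `𝒱` -/

section GelfandTriple

variable {V : Type*} [NormedAddCommGroup V] [InnerProductSpace ℝ V] [CompleteSpace V]
variable {H : Type*} [NormedAddCommGroup H] [InnerProductSpace ℝ H] [CompleteSpace H]

/-- For `j = id` the pivot map is the Riesz isomorphism of `V`. -/
theorem inner_pivot_id (f : StrongDual ℝ V) (v : V) :
    ⟪f, pivot (ContinuousLinearMap.id ℝ V) v⟫ = f v := by
  have h : (InnerProductSpace.toDual ℝ V).symm (pivot (ContinuousLinearMap.id ℝ V) v) = v :=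
    (InnerProductSpace.toDual ℝ V).symm_apply_eq.2 rfl
  change ⟪(InnerProductSpace.toDual ℝ V).symm f,
    (InnerProductSpace.toDual ℝ V).symm (pivot (ContinuousLinearMap.id ℝ V) v)⟫ = f v
  rw [h, InnerProductSpace.toDual_symm_apply]

/-- The operator `V* → H` dual to `T : H → V`. -/
noncomputable def dualOfIntoV (T : H →L[ℝ] V) : StrongDual ℝ V →L[ℝ] H :=
  ContinuousLinearMap.adjoint (pivot (ContinuousLinearMap.id ℝ V) ∘L T)

theorem inner_dualOfIntoV (T : H →L[ℝ] V) (f : StrongDual ℝ V) (h : H) :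
    ⟪dualOfIntoV T f, h⟫ = f (T h) := by
  rw [dualOfIntoV, ContinuousLinearMap.adjoint_inner_left, ContinuousLinearMap.comp_apply,
    inner_pivot_id]

theorem isHilbertSchmidt_dualOfIntoV {T : H →L[ℝ] V} (hT : IsHilbertSchmidt T) :
    IsHilbertSchmidt (dualOfIntoV T) := by
  refine IsHilbertSchmidt.adjoint ?_
  obtain ⟨w, e, he⟩ := hT
  have hn : ∀ v : V, ‖pivot (ContinuousLinearMap.id ℝ V) v‖ = ‖v‖ := fun v =>
    (InnerProductSpace.toDual ℝ V).norm_map v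
  exact ⟨w, e, by simpa [hn] using he⟩

/-- A Hilbert--Schmidt operator `H → V` that is symmetric as an operator on `H` is in `𝒱`. -/
noncomputable def OperatorV.ofSymmetric {j : V →L[ℝ] H} {T : H →L[ℝ] V} (hT : IsHilbertSchmidt T)
    (hs : ∀ h k, ⟪j (T h), k⟫ = ⟪h, j (T k)⟫) : OperatorV j where
  ofDual := dualOfIntoV T
  intoV := T
  isHilbertSchmidt_ofDual := isHilbertSchmidt_dualOfIntoV hT
  isHilbertSchmidt_intoV := hT
  compat := by
    ext h
    refine ext_inner_right ℝ fun k => ?_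
    simp [inner_dualOfIntoV, hs]

end GelfandTriple

/-! ### The invariant set and the contraction -/

section FixedPoint

variable {ι : Type*}
variable {H : Type*} [NormedAddCommGroup H] [InnerProductSpace ℝ H] [CompleteSpace H]

/-- The symmetric Hilbert--Schmidt operators `P` on `H` with `a ≤ P ≤ b`. -/
def boundedSeq (e : HilbertBasis ι ℝ H) (a b : ℝ) : Set (SqSum ι H) :=
  {p | (∀ h k, ⟪opOfSeq e p h, k⟫ = ⟪h, opOfSeq e p k⟫) ∧
    ∀ u, a * ‖u‖ ^ 2 ≤ ⟪opOfSeq e p u, u⟫ ∧ ⟪opOfSeq e p u, u⟫ ≤ b * ‖u‖ ^ 2}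

theorem isClosed_boundedSeq (e : HilbertBasis ι ℝ H) (a b : ℝ) :
    IsClosed (boundedSeq e a b) := by
  simp only [boundedSeq, Set.ofPred_and, Set.ofPred_forall]
  refine (isClosed_iInter fun h => isClosed_iInter fun k => isClosed_eq ?_ ?_).inter
    (isClosed_iInter fun u => (isClosed_le ?_ ?_).inter (isClosed_le ?_ ?_)) <;> fun_prop

/-- The operator `Q + 2 M P - P²`. -/
noncomputable def shiftedRhs (e : HilbertBasis ι ℝ H) (q : SqSum ι H) (M : ℝ) (p : SqSum ι H) :
    SqSum ι H :=
  q + (2 * M) • p - lpMap (opOfSeq e p) p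

theorem opOfSeq_shiftedRhs (e : HilbertBasis ι ℝ H) (q : SqSum ι H) (M : ℝ) (p : SqSum ι H)
    (u : H) : opOfSeq e (shiftedRhs e q M p) u =
      opOfSeq e q u + (2 * M) • opOfSeq e p u - opOfSeq e p (opOfSeq e p u) := by
  simp [shiftedRhs, opOfSeq_lpMap]

variable {e : HilbertBasis ι ℝ H} {p p' q : SqSum ι H} {γ M : ℝ}

theorem symmetric_shiftedRhs (hq : ∀ h k, ⟪opOfSeq e q h, k⟫ = ⟪h, opOfSeq e q k⟫)
    (hp : ∀ h k, ⟪opOfSeq e p h, k⟫ = ⟪h, opOfSeq e p k⟫) (h k : H) :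
    ⟪opOfSeq e (shiftedRhs e q M p) h, k⟫ = ⟪h, opOfSeq e (shiftedRhs e q M p) k⟫ := by
  simp only [opOfSeq_shiftedRhs, inner_add_left, inner_add_right, inner_sub_left, inner_sub_right,
    real_inner_smul_left, real_inner_smul_right, hq h, hp h, hp (opOfSeq e p h)]

theorem norm_smul_id_sub_le (hγ : 0 ≤ γ) (hM : 0 < M) (hp : p ∈ boundedSeq e (-γ) M) :
    ‖M • ContinuousLinearMap.id ℝ H - opOfSeq e p‖ ≤ M + γ := by
  refine norm_le_of_symmetric_of_le (fun u v => ?_) (fun u => ?_) (by linarith) fun u => ?_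
  · simp [inner_sub_left, inner_sub_right, real_inner_smul_left, real_inner_smul_right, hp.1 u]
  · have := (hp.2 u).2
    simp [inner_sub_left, real_inner_smul_left, this]
  · have := (hp.2 u).1
    simp only [sub_apply, smul_apply, ContinuousLinearMap.id_apply, inner_sub_left,
      real_inner_smul_left, real_inner_self_eq_norm_sq]
    linarith

/-- Completing the square. -/
theorem inner_shiftedRhs (hp : ∀ h k, ⟪opOfSeq e p h, k⟫ = ⟪h, opOfSeq e p k⟫) (u : H) :
    ⟪opOfSeq e (shiftedRhs e q M p) u, u⟫ = ⟪opOfSeq e q u, u⟫ + M ^ 2 * ‖u‖ ^ 2 -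
      ‖(M • ContinuousLinearMap.id ℝ H - opOfSeq e p) u‖ ^ 2 := by
  simp only [opOfSeq_shiftedRhs, ← real_inner_self_eq_norm_sq, sub_apply, smul_apply,
    ContinuousLinearMap.id_apply, inner_add_left, inner_sub_left, inner_sub_right,
    real_inner_smul_left, real_inner_smul_right]
  rw [hp (opOfSeq e p u) u, hp u u]
  ring

theorem norm_shiftedRhs_sub_le (hγ : 0 ≤ γ) (hM : 0 < M) (hp : p ∈ boundedSeq e (-γ) M)
    (hp' : p' ∈ boundedSeq e (-γ) M) :
    ‖shiftedRhs e q M p - shiftedRhs e q M p'‖ ≤ 2 * (M + γ) * ‖p - p'‖ := by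
  set d := p - p' with hd
  set X := M • ContinuousLinearMap.id ℝ H - opOfSeq e p with hX
  set X' := M • ContinuousLinearMap.id ℝ H - opOfSeq e p' with hX'
  set z := shiftedRhs e q M p - shiftedRhs e q M p' - lpMap X d with hz
  have hop : opOfSeq e z = opOfSeq e d ∘L X' := by
    ext u
    simp only [hz, hd, hX, hX', map_sub, sub_apply, smul_apply, ContinuousLinearMap.id_apply,
      opOfSeq_lpMap, ContinuousLinearMap.comp_apply, opOfSeq_shiftedRhs, map_smul]
    module
  have hds : ∀ u v, ⟪opOfSeq e d u, v⟫ = ⟪u, opOfSeq e d v⟫ := fun u v => by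
    simp [hd, inner_sub_left, inner_sub_right, hp.1 u, hp'.1 u]
  have hXs : ∀ u v, ⟪X' u, v⟫ = ⟪u, X' v⟫ := fun u v => by
    simp [hX', inner_sub_left, inner_sub_right, real_inner_smul_left, real_inner_smul_right,
      hp'.1 u]
  -- In `D (M - P')` the bounded factor acts on the right, out of reach of `lpMap`; passing to the
  -- adjoint moves it to the left.
  have hadj : opOfSeq e z = ContinuousLinearMap.adjoint (opOfSeq e (lpMap X' d)) := by
    rw [ContinuousLinearMap.eq_adjoint_iff]
    intro u v
    rw [hop, opOfSeq_lpMap, ContinuousLinearMap.comp_apply, ContinuousLinearMap.comp_apply, hds,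
      hXs]
  have hzn := norm_eq_of_opOfSeq_eq_adjoint hadj
  have h1 : ‖lpMap X d‖ ≤ (M + γ) * ‖d‖ := (norm_lpMap_apply_le X d).trans
    (mul_le_mul_of_nonneg_right (norm_smul_id_sub_le hγ hM hp) (norm_nonneg _))
  have h2 : ‖lpMap X' d‖ ≤ (M + γ) * ‖d‖ := (norm_lpMap_apply_le X' d).trans
    (mul_le_mul_of_nonneg_right (norm_smul_id_sub_le hγ hM hp') (norm_nonneg _))
  have h3 : shiftedRhs e q M p - shiftedRhs e q M p' = z + lpMap X d := by rw [hz]; abel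
  rw [h3]
  linarith [norm_add_le z (lpMap X d)]

variable {V : Type*} [NormedAddCommGroup V] [InnerProductSpace ℝ V] [CompleteSpace V]

/-- The fixed point of the map that sends `P` to the solution `R` of the Lyapunov equation
`B* R + R B = Q + 2 M P - P²`. -/
theorem exists_fixedPoint_lyapunov {j : V →L[ℝ] H} (hj : IsCompactOperator j) {B : V →L[ℝ] V}
    {μ : ℝ} (hμ : 0 < μ) (hBV : ∀ v, μ * ‖v‖ ^ 2 ≤ ⟪B v, v⟫)
    {b : ℝ} (hB : ∀ v, b * ‖j v‖ ^ 2 ≤ ⟪B v, v⟫)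
    (hq : ∀ h k, ⟪opOfSeq e q h, k⟫ = ⟪h, opOfSeq e q k⟫)
    (hqγ : ∀ u, -γ ^ 2 * ‖u‖ ^ 2 ≤ ⟪opOfSeq e q u, u⟫)
    (hγ : 0 ≤ γ) (hM : 0 < M) (hb : M + γ < b)
    (hqM : ∀ u, ⟪opOfSeq e q u, u⟫ ≤ (2 * b * M - M ^ 2) * ‖u‖ ^ 2) :
    ∃ x ∈ symmSeq e j, lpMap j x ∈ boundedSeq e (-γ) M ∧
      ∀ y ∈ symmSeq e j, 2 * ⟪lpMap B x, y⟫ = ⟪shiftedRhs e q M (lpMap j x), lpMap j y⟫ := by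
  have hb0 : 0 < b := by linarith
  choose X hXs hX using fun p => exists_lyapunov_weak e j B hμ hBV (shiftedRhs e q M p)
  have hmaps : Set.MapsTo (fun p => lpMap j (X p)) (boundedSeq e (-γ) M)
      (boundedSeq e (-γ) M) := by
    intro p hp
    have hL := lyapunov_of_weak (symmetric_shiftedRhs (M := M) hq hp.1) (hX p)
    have hform := inner_shiftedRhs (q := q) (M := M) hp.1
    have hN : ∀ u, ‖(M • ContinuousLinearMap.id ℝ H - opOfSeq e p) u‖ ^ 2 ≤
        (M + γ) ^ 2 * ‖u‖ ^ 2 := fun u => by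
      rw [← mul_pow]
      gcongr
      exact ContinuousLinearMap.le_of_opNorm_le _ (norm_smul_id_sub_le hγ hM hp) u
    simp only [boundedSeq, Set.mem_ofPred_eq, opOfSeq_lpMap, ContinuousLinearMap.comp_apply]
    refine ⟨hXs p, fun u => ⟨?_, ?_⟩⟩
    · refine neg_mul_norm_sq_le_of_lyapunov hj hB hb0 (hXs p) hL hγ (fun u => ?_) u
      rw [hform]
      -- Half the slack in `-2 b γ ≤ -γ² + M² - (M + γ)²`.
      have h1 : 0 ≤ (b - (M + γ)) * γ * ‖u‖ ^ 2 := by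
        have := sub_nonneg.2 hb.le
        positivity
      nlinarith [hN u, hqγ u]
    · refine le_mul_norm_sq_of_lyapunov hj hB hb0 (hXs p) hL hM.le (fun u => ?_) u
      rw [hform]
      nlinarith [hqM u, sq_nonneg ‖(M • ContinuousLinearMap.id ℝ H - opOfSeq e p) u‖]
  have hlip : ContractingWith ((M + γ) / b).toNNReal
      (hmaps.restrict (fun p => lpMap j (X p)) _ _) := by
    refine ⟨?_, LipschitzWith.of_dist_le_mul fun p p' => ?_⟩
    · rw [Real.toNNReal_lt_one, div_lt_one hb0]
      exact hb
    · rw [Real.coe_toNNReal _ (by positivity), Subtype.dist_eq, Subtype.dist_eq, dist_eq_norm,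
        dist_eq_norm, div_mul_eq_mul_div, le_div_iff₀ hb0]
      have h1 := mul_norm_sub_le_of_lyapunov hB (hXs p) (hXs p') (hX p) (hX p')
      have h2 := norm_shiftedRhs_sub_le (q := q) hγ hM p.2 p'.2
      simp only [Set.MapsTo.val_restrict_apply]
      linarith
  have h0 : (0 : SqSum ι H) ∈ boundedSeq e (-γ) M := by
    refine ⟨by simp, fun u => ?_⟩
    simp only [map_zero, zero_apply, inner_zero_left]
    constructor <;> nlinarith [sq_nonneg ‖u‖]
  obtain ⟨p, hp, hfix, -⟩ := hlip.exists_fixedPoint' (isClosed_boundedSeq e _ _).isComplete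
    hmaps h0 (edist_ne_top _ _)
  have hfix' : lpMap j (X p) = p := hfix
  exact ⟨X p, hXs p, by rwa [hfix'], by rw [hfix']; exact hX p⟩

end FixedPoint

end RiccatiHS

/-! ### The Riccati equation -/

theorem mainTheorem1
    {V : Type*} [NormedAddCommGroup V] [InnerProductSpace ℝ V] [CompleteSpace V]
    [TopologicalSpace.SeparableSpace V]
    {H : Type*} [NormedAddCommGroup H] [InnerProductSpace ℝ H] [CompleteSpace H]
    [TopologicalSpace.SeparableSpace H]
    (j : V →L[ℝ] H) (hj_inj : Function.Injective j) (hj_dense : DenseRange j)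
    (hj_compact : IsCompactOperator j)
    (A : V →L[ℝ] StrongDual ℝ V)
    (hA : ∃ μV : ℝ, 0 < μV ∧ ∀ u : V, μV * ‖u‖ ^ 2 ≤ A u u)
    (μH : ℝ) (hμH : ∀ u : V, μH * ‖j u‖ ^ 2 ≤ A u u)
    (γ : ℝ) (hγ₀ : 0 ≤ γ) (hγ : γ < μH)
    (Q : H →L[ℝ] H) (hQ : Q ∈ RiccatiHS.lowerBoundedHS H (-(γ ^ 2))) :
    ∃ P : RiccatiHS.OperatorV j,
      P.toH ∈ RiccatiHS.lowerBoundedHS H (-γ) ∧ RiccatiHS.IsRiccatiSolution j A Q P := by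
  open RiccatiHS in
  obtain ⟨μV, hμV, hAV⟩ := hA
  obtain ⟨hQHS, hQsa, hQγ⟩ := hQ
  obtain ⟨w, e, -⟩ := exists_hilbertBasis ℝ H
  obtain ⟨q, rfl⟩ := hQHS.exists_opOfSeq_eq e
  have hμ0 : 0 < μH := by linarith
  have hq : ∀ h k, inner ℝ (opOfSeq e q h) k = inner ℝ h (opOfSeq e q k) := hQsa.isSymmetric
  -- Chosen so that `‖Q‖ ≤ μH M`, which gives the upper bound `R ≤ M`; the `+ 1` keeps `M` positive
  -- when `Q = 0`.
  let M : ℝ := ‖opOfSeq e q‖ / μH + 1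
  have hM : 0 < M := by positivity
  have hMq : ‖opOfSeq e q‖ ≤ μH * M := by
    have : μH * M = ‖opOfSeq e q‖ + μH := by simp only [M]; field_simp
    linarith
  -- Riesz representative of `A* + M`; the flip is there because `A*`, not `A`, acts on the values
  -- of `P`.
  let B : V →L[ℝ] V := InnerProductSpace.continuousLinearMapOfBilin (𝕜 := ℝ) A.flip +
    M • (ContinuousLinearMap.adjoint j ∘L j)
  have hB : ∀ u v, inner ℝ (B u) v = A v u + M * inner ℝ (j u) (j v) := fun u v => by
    simp [B, inner_add_left, real_inner_smul_left, ContinuousLinearMap.adjoint_inner_left]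
  have hBself : ∀ v, inner ℝ (B v) v = A v v + M * ‖j v‖ ^ 2 := fun v => by
    rw [hB, real_inner_self_eq_norm_sq]
  obtain ⟨x, hxs, hxb, hx⟩ := exists_fixedPoint_lyapunov (e := e) (q := q) (γ := γ) (M := M)
    (b := μH + M) hj_compact (B := B) hμV
    (fun v => by
      rw [hBself]
      have : 0 ≤ M * ‖j v‖ ^ 2 := by positivity
      linarith [hAV v])
    (fun v => by rw [hBself]; linarith [hμH v]) hq
    (fun u => by
      have := hQγ u
      simp only [sub_apply, smul_apply, ContinuousLinearMap.id_apply, inner_sub_left,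
        real_inner_smul_left, real_inner_self_eq_norm_sq] at this
      linarith)
    hγ₀ hM (by linarith)
    (fun u => by
      have h1 := real_inner_le_norm (opOfSeq e q u) u
      have h2 := (opOfSeq e q).le_opNorm u
      have h3 : ‖opOfSeq e q u‖ * ‖u‖ ≤ ‖opOfSeq e q‖ * ‖u‖ * ‖u‖ := by gcongr
      have h4 : ‖opOfSeq e q‖ * ‖u‖ ^ 2 ≤ (2 * (μH + M) * M - M ^ 2) * ‖u‖ ^ 2 := by
        gcongr
        nlinarith [mul_pos hμ0 hM]
      linarith)
  have hL := lyapunov_of_weak (symmetric_shiftedRhs (M := M) hq hxb.1) hx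
  refine ⟨OperatorV.ofSymmetric (isHilbertSchmidt_opOfSeq e x) hxs, ⟨?_, ?_, fun u => ?_⟩, ?_⟩
  · have h := isHilbertSchmidt_opOfSeq e (lpMap j x)
    rwa [opOfSeq_lpMap] at h
  · exact ContinuousLinearMap.isSelfAdjoint_iff_isSymmetric.2 hxs
  · have h := (hxb.2 u).1
    rw [opOfSeq_lpMap, ContinuousLinearMap.comp_apply] at h
    simp only [OperatorV.toH, OperatorV.ofSymmetric, sub_apply, smul_apply,
      ContinuousLinearMap.comp_apply, ContinuousLinearMap.id_apply, inner_sub_left,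
      real_inner_smul_left, real_inner_self_eq_norm_sq]
    linarith
  · ext u v
    have h := hL u v
    simp only [hB, opOfSeq_shiftedRhs, opOfSeq_lpMap, ContinuousLinearMap.comp_apply,
      inner_add_left, inner_sub_left, real_inner_smul_left] at h
    -- By symmetry of `P` the two shift terms coincide and cancel `2 M P`.
    have hc : inner ℝ (j (opOfSeq e x (j v))) (j u) = inner ℝ (j (opOfSeq e x (j u))) (j v) := by
      rw [hxs (j v) (j u), real_inner_comm]
    simp only [lyapunov, toVDual, OperatorV.dualMul, OperatorV.mulOp, OperatorV.toH,
      OperatorV.ofSymmetric, dualOperator, add_apply, ContinuousLinearMap.comp_apply, pivot_apply,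
      ContinuousLinearMap.flip_apply, inner_dualOfIntoV]
    rw [hc] at h
    linarith
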